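/- Let $\Gamma_0\subset\mathrm{PSL}_2(\mathbb R)$ be a Fuchsian group (a discrete subgroup), acting on the upper half-plane $\mathbb H$ by fractional linear transformations, and assume that $\Gamma_0$ is cocompact, i.e. that $\Gamma_0\backslash\mathbb H$ is compact (such a group is automatically a Fuchsian group of the first kind). For a subgroup $\Gamma\subseteq\Gamma_0$ of finite index and an integer $k\ge 1$, let $\mathcal S_{2k}^{\Gamma}$ be the space of cusp forms of weight $2k$ for $\Gamma$, i.e. of holomorphic functions $f:\mathbb H\to\mathbb C$ with $f(\gamma z)=(cz+d)^{2k}f(z)$ for all $\gamma=\left(\begin{smallmatrix}a&b\\c&d\end{smallmatrix}\right)\in\Gamma$ which vanish at all cusps of $\Gamma$, with the Petersson inner product $$\langle f,g\rangle=\int_{\Gamma\backslash\mathbb H}f(z)\overline{g(z)}\,y^{2k}\,\frac{dx\,dy}{y^2}\qquad(z=x+iy).$$ Then there is a constant $C$, depending only on $\Gamma_0$, such that for every subgroup $\Gamma\subseteq\Gamma_0$ of finite index and every integer $k\ge 1$ the space $\mathcal S_{2k}^{\Gamma}$ is finite-dimensional and has an orthonormal basis, and for every orthonormal basis $f_1,\dots,f_d$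 of it the function $$S_k^{\Gamma}(z)=\sum_{j=1}^{d}|f_j(z)|^2\,\mathrm{Im}(z)^{2k}$$ satisfies $$\sup_{z\in\Gamma\backslash\mathbb H}S_k^{\Gamma}(z)\le C\,k.$$ -/

import Mathlib

open scoped MatrixGroups UpperHalfPlane Pointwise
open UpperHalfPlane MeasureTheory

namespace Fuchsian

/-- The action of `PSL(2, ℝ)` on `ℍ` by fractional linear transformations. -/
noncomputable instance pslAction : MulAction PSL(2, ℝ) ℍ :=
  MulAction.compHom ℍ (QuotientGroup.lift (Subgroup.center SL(2, ℝ))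
    (MulAction.toPermHom SL(2, ℝ) ℍ) (by
      intro g hg
      ext1 z
      have : (Matrix.SpecialLinearGroup.mapGL ℝ g) ∈ Subgroup.center (GL (Fin 2) ℝ) := by
        obtain ⟨r, hr, hg⟩ := Matrix.SpecialLinearGroup.mem_center_iff.mp hg
        rw [Matrix.GeneralLinearGroup.mem_center_iff_val_mem_range_scalar]
        exact ⟨r, by simpa using hg⟩
      exact (forall_smul_eq_self_iff_mem_center.mpr this) z))

theorem mk_smul (g : SL(2, ℝ)) (z : ℍ) : (QuotientGroup.mk g : PSL(2, ℝ)) • z = g • z := rfl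

theorem mk_eq_one_iff (g : SL(2, ℝ)) : (QuotientGroup.mk g : PSL(2, ℝ)) = 1 ↔
    Matrix.SpecialLinearGroup.mapGL ℝ g ∈ Subgroup.center (GL (Fin 2) ℝ) := by
  rw [QuotientGroup.eq_one_iff, Matrix.SpecialLinearGroup.mem_center_iff,
    Matrix.GeneralLinearGroup.mem_center_iff_val_mem_range_scalar]
  constructor
  · rintro ⟨r, -, h⟩
    exact ⟨r, by simpa using h⟩
  · rintro ⟨r, h⟩
    have h' : Matrix.scalar (Fin 2) r = (g : Matrix (Fin 2) (Fin 2) ℝ) := by simpa using h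
    refine ⟨r, ?_, h'⟩
    have := g.det_coe
    rw [← h'] at this
    simpa using this

theorem mk_smul_eq_self (g : PSL(2, ℝ)) (hg : g ≠ 1) : {z : ℍ | g • z = z}.Subsingleton := by
  induction g using QuotientGroup.induction_on with
  | H g =>
    intro z hz w hw
    have hd : 0 < (Matrix.SpecialLinearGroup.mapGL ℝ g).val.det := by simp
    have hz' : Matrix.SpecialLinearGroup.mapGL ℝ g • z = z := hz
    have hw' : Matrix.SpecialLinearGroup.mapGL ℝ g • w = w := hw
    have hell := isElliptic_of_exists_smul_eq_self hd
      (fun h => hg ((mk_eq_one_iff g).mpr h)) ⟨z, hz'⟩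
    rw [gl_smul_eq_self_iff_eq_fixedPt hd hell] at hz' hw'
    rw [hz', hw']

theorem volume_subsingleton {s : Set ℍ} (hs : s.Subsingleton) : (volume : Measure ℍ) s = 0 := by
  rw [volume_eq_lintegral, setLIntegral_measure_zero]
  exact (hs.image _).measure_zero _

instance pslSMulInvariant : SMulInvariantMeasure PSL(2, ℝ) ℍ volume := by
  constructor
  intro g s hs
  induction g using QuotientGroup.induction_on with
  | H g => exact measure_preimage_smul (volume : Measure ℍ) (Matrix.SpecialLinearGroup.mapGL ℝ g) s

instance pslContinuous : ContinuousConstSMul PSL(2, ℝ) ℍ := by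
  constructor
  intro g
  induction g using QuotientGroup.induction_on with
  | H g => exact continuous_const_smul (T := ℍ) g

theorem secondCountable_sl : SecondCountableTopology SL(2, ℝ) :=
  have : SecondCountableTopology (Matrix (Fin 2) (Fin 2) ℝ) :=
    inferInstanceAs (SecondCountableTopology (Fin 2 → Fin 2 → ℝ))
  Matrix.SpecialLinearGroup.isClosedEmbedding_val.toIsEmbedding.secondCountableTopology

theorem countable_of_discrete (Γ : Subgroup PSL(2, ℝ)) [DiscreteTopology Γ] : Countable Γ := by
  have := secondCountable_sl
  have : SecondCountableTopology PSL(2, ℝ) := inferInstance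
  exact countable_of_Lindelof_of_discrete

theorem discrete_comap (Γ : Subgroup PSL(2, ℝ)) [DiscreteTopology Γ] :
    DiscreteTopology (Γ.comap (QuotientGroup.mk' (Subgroup.center SL(2, ℝ)))) := by
  rw [discreteTopology_iff_isOpen_singleton_one]
  have h1 : IsOpen ({1} : Set Γ) := isOpen_discrete _
  obtain ⟨U, hU, hU1⟩ := isOpen_induced_iff.mp h1
  refine isOpen_induced_iff.mpr ⟨(QuotientGroup.mk ⁻¹' U) ∩ {g : SL(2, ℝ) | 0 < g 0 0},
    (hU.preimage QuotientGroup.continuous_mk).inter ?_, ?_⟩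
  · refine isOpen_lt continuous_const ?_
    exact (Matrix.SpecialLinearGroup.isClosedEmbedding_val.continuous).matrix_elem 0 0
  · ext ⟨g, hg⟩
    have key : ∀ h : Γ, (h : PSL(2, ℝ)) ∈ U ↔ h = 1 := fun h => by
      rw [← Set.mem_singleton_iff, ← hU1]; rfl
    simp only [Set.mem_preimage, Set.mem_inter_iff, Set.mem_ofPred_eq, Set.mem_singleton_iff]
    constructor
    · rintro ⟨h1, h2⟩
      have h3 := (key ⟨QuotientGroup.mk g, hg⟩).mp h1
      have h4 : (QuotientGroup.mk g : PSL(2, ℝ)) = 1 := congrArg Subtype.val h3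
      rw [QuotientGroup.eq_one_iff, Matrix.SpecialLinearGroup.mem_center_iff] at h4
      obtain ⟨r, hr, hg'⟩ := h4
      have h00 : g 0 0 = r := by rw [← hg']; simp
      have hr1 : r = 1 := by
        rw [h00] at h2
        have : r ^ 2 = 1 := by simpa using hr
        nlinarith
      ext i j
      change g i j = (1 : Matrix (Fin 2) (Fin 2) ℝ) i j
      rw [← hg', hr1]
      simp
    · intro h
      have h1 : g = 1 := congrArg Subtype.val h
      subst h1
      exact ⟨(key 1).mpr rfl, by simp⟩

theorem properlyDiscontinuous (Γ : Subgroup PSL(2, ℝ)) [DiscreteTopology Γ] :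
    ProperlyDiscontinuousSMul Γ ℍ := by
  have := discrete_comap Γ
  constructor
  intro K L hK hL
  have h := ProperlyDiscontinuousSMul.finite_disjoint_inter_image
    (Γ := (Γ.comap (QuotientGroup.mk' (Subgroup.center SL(2, ℝ))))) hK hL
  refine (h.image (fun g => (⟨QuotientGroup.mk g.1, g.2⟩ : Γ))).subset ?_
  rintro ⟨g, hg⟩ hne
  induction g using QuotientGroup.induction_on with
  | H g => exact ⟨⟨g, hg⟩, hne, rfl⟩

/-- A discrete subgroup of `PSL(2, ℝ)` has a fundamental domain in `ℍ`. -/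
theorem exists_isFundamentalDomain (Γ : Subgroup PSL(2, ℝ)) [DiscreteTopology Γ] :
    ∃ D : Set ℍ, IsFundamentalDomain Γ D volume := by
  have := countable_of_discrete Γ
  have := properlyDiscontinuous Γ
  have : ContinuousConstSMul Γ ℍ := ⟨fun γ => continuous_const_smul (γ : PSL(2, ℝ))⟩
  have hU : ∀ z : ℍ, ∃ U : Set ℍ, IsOpen U ∧ z ∈ U ∧
      ∀ γ : Γ, ∀ w ∈ U, γ • w ∈ U → γ • z = z := by
    intro z
    obtain ⟨V, hV, h⟩ := ProperlyDiscontinuousSMul.exists_nhds_image_smul_eq_self Γ z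
    obtain ⟨U, hUV, hU, hz⟩ := mem_nhds_iff.mp hV
    exact ⟨U, hU, hz, fun γ w hw hw' => h γ ⟨_, ⟨w, hUV hw, rfl⟩, hUV hw'⟩⟩
  choose U hUo hUz hUγ using hU
  let F : Set ℍ := {z | ∀ γ : Γ, γ • z = z → γ = 1}
  obtain ⟨T, hT, hTU⟩ := TopologicalSpace.isOpen_iUnion_countable (fun z : F => U z)
    (fun z => hUo z)
  have := hT.to_subtype
  obtain ⟨e, he⟩ := Countable.exists_injective_nat T
  let A : T → Set ℍ := fun t => ⋃ γ : Γ, (fun z => γ • z) ⁻¹' U t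
  have hA : ∀ t, MeasurableSet (A t) := fun t =>
    MeasurableSet.iUnion fun γ => ((hUo _).preimage (continuous_const_smul γ)).measurableSet
  have hAγ : ∀ t (γ : Γ) z, z ∈ A t → γ • z ∈ A t := by
    intro t γ z hz
    obtain ⟨δ, hδ⟩ := Set.mem_iUnion.mp hz
    exact Set.mem_iUnion.mpr ⟨δ * γ⁻¹, by simpa [smul_smul] using hδ⟩
  have hUA : ∀ t : T, U t ⊆ A t := fun t z hz => Set.mem_iUnion.mpr ⟨1, by simpa using hz⟩
  let D : Set ℍ := ⋃ t : T, U t \ ⋃ s : {s : T // e s < e t}, A s.1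
  have hD : MeasurableSet D := by
    refine MeasurableSet.iUnion fun t => MeasurableSet.diff ?_ (MeasurableSet.iUnion fun s => ?_)
    · exact (hUo _).measurableSet
    · exact hA _
  refine ⟨D, IsFundamentalDomain.mk'' ?_ ?_ ?_ ?_⟩
  · exact hD.nullMeasurableSet
  · have hF : volume Fᶜ = 0 := by
      refine measure_mono_null (t := ⋃ γ : {γ : Γ // γ ≠ 1}, {z : ℍ | (γ : Γ) • z = z}) ?_
        (measure_iUnion_null fun γ => volume_subsingleton
          (mk_smul_eq_self (γ : Γ) (fun h => γ.2 (Subtype.ext h))))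
      intro z hz
      simp only [F, Set.mem_compl_iff, Set.mem_ofPred_eq, not_forall] at hz
      obtain ⟨γ, h1, h2⟩ := hz
      exact Set.mem_iUnion.mpr ⟨⟨γ, h2⟩, h1⟩
    filter_upwards [compl_mem_ae_iff.mpr hF] with z hz
    have hz : z ∈ F := by simpa using hz
    have hex : ∃ t : T, z ∈ A t := by
      have : z ∈ ⋃ z : F, U z := Set.mem_iUnion.mpr ⟨⟨z, hz⟩, hUz z⟩
      rw [← hTU] at this
      obtain ⟨t, ht, hzt⟩ := Set.mem_iUnion₂.mp this
      exact ⟨⟨t, ht⟩, hUA ⟨t, ht⟩ hzt⟩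
    obtain ⟨t, ht, hmin⟩ := (measure e).wf.has_min {t | z ∈ A t} hex
    obtain ⟨γ, hγ⟩ := Set.mem_iUnion.mp ht
    refine ⟨γ, Set.mem_iUnion.mpr ⟨t, hγ, fun h => ?_⟩⟩
    obtain ⟨⟨s, hs⟩, h⟩ := Set.mem_iUnion.mp h
    exact hmin s (by simpa using hAγ s γ⁻¹ _ h) hs
  · intro γ hγ
    refine Disjoint.aedisjoint (Set.disjoint_left.mpr ?_)
    rintro _ ⟨w, hw, rfl⟩ hw'
    obtain ⟨t, ht, ht'⟩ := Set.mem_iUnion.mp hw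
    obtain ⟨s, hs, hs'⟩ := Set.mem_iUnion.mp hw'
    rcases lt_trichotomy (e s) (e t) with h | h | h
    · exact ht' (Set.mem_iUnion.mpr ⟨⟨s, h⟩, by simpa using hAγ s γ⁻¹ _ (hUA s hs)⟩)
    · obtain rfl := he h
      exact hγ ((s : F).2 γ (hUγ _ γ w ht hs))
    · exact hs' (Set.mem_iUnion.mpr ⟨⟨t, h⟩, hAγ t γ _ (hUA t ht)⟩)
  · exact fun γ => (measurePreserving_smul γ (volume : Measure ℍ)).quasiMeasurePreserving


/-- A Fuchsian group: a discrete subgroup of `PSL(2, ℝ)`, for the quotient topology. -/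
def IsFuchsian (Γ : Subgroup PSL(2, ℝ)) : Prop := DiscreteTopology Γ

/-- The quotient space `M = Γ \ ℍ`, with the quotient topology. -/
abbrev quotientSpace (Γ : Subgroup PSL(2, ℝ)) : Type := MulAction.orbitRel.Quotient Γ ℍ

/-- `Γ` is cocompact if `Γ \ ℍ` is compact. -/
def IsCocompact (Γ : Subgroup PSL(2, ℝ)) : Prop := CompactSpace (quotientSpace Γ)

/-- The group of all real matrices of determinant one whose class in `PSL(2, ℝ)` lies in `Γ`,
as a subgroup of `GL(2, ℝ)`. -/
def matrixGroup (Γ : Subgroup PSL(2, ℝ)) : Subgroup (GL (Fin 2) ℝ) :=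
  (Γ.comap (QuotientGroup.mk' (Subgroup.center SL(2, ℝ)))).map Matrix.SpecialLinearGroup.toGL

instance matrixGroup_hasDetOne (Γ : Subgroup PSL(2, ℝ)) : (matrixGroup Γ).HasDetOne := by
  unfold matrixGroup; infer_instance

/-- The space of cusp forms of weight `2k` for `Γ`: holomorphic functions `f` on `ℍ` such that
`f (γ z) = (c z + d) ^ (2 k) f z` for all `γ = [a, b; c, d]` in `Γ` (the sign of the matrix does
not matter, the weight being even), which vanish at all cusps of `Γ`. -/
abbrev CuspForms (Γ : Subgroup PSL(2, ℝ)) (k : ℕ) : Type := CuspForm (matrixGroup Γ) (2 * k : ℤ)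

/-- A fundamental domain for the action of `Γ` on `ℍ`, with respect to the hyperbolic area
`dx dy / y ^ 2` (the `volume` of `ℍ`). -/
noncomputable def fundamentalDomain (Γ : Subgroup PSL(2, ℝ)) : Set ℍ :=
  Classical.epsilon fun D : Set ℍ => IsFundamentalDomain Γ D volume

theorem isFundamentalDomain (Γ : Subgroup PSL(2, ℝ)) (hΓ : IsFuchsian Γ) :
    IsFundamentalDomain Γ (fundamentalDomain Γ) volume :=
  have : DiscreteTopology Γ := hΓ
  Classical.epsilon_spec (exists_isFundamentalDomain Γ)

/-- The Petersson inner product `∫_M f(z) conj(g(z)) y ^ (2k) dx dy / y ^ 2`. The integral over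
`M = Γ \ ℍ` of a `Γ`-invariant function is its integral over a fundamental domain; it does not
depend on which one. -/
noncomputable def peterssonInner (Γ : Subgroup PSL(2, ℝ)) (k : ℕ) (f g : CuspForms Γ k) : ℂ :=
  ∫ z in fundamentalDomain Γ, f z * (starRingEnd ℂ) (g z) * (z.im : ℂ) ^ (2 * k)

/-- `b` is an orthonormal basis `f_1, …, f_d` of the space of cusp forms of weight `2k` for
`Γ`, where `d` is the dimension of this space. -/
def IsOrthonormalBasis (Γ : Subgroup PSL(2, ℝ)) (k : ℕ)
    (b : Module.Basis (Fin (Module.finrank ℂ (CuspForms Γ k))) ℂ (CuspForms Γ k)) : Prop :=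
  ∀ i j, peterssonInner Γ k (b i) (b j) = if i = j then 1 else 0

/-- The function `S_k^Γ(z) = ∑_j |f_j(z)| ^ 2 Im(z) ^ (2k)` attached to a basis. -/
noncomputable def sumSq (Γ : Subgroup PSL(2, ℝ)) (k : ℕ)
    (b : Module.Basis (Fin (Module.finrank ℂ (CuspForms Γ k))) ℂ (CuspForms Γ k)) (z : ℍ) : ℝ :=
  ∑ j, ‖b j z‖ ^ 2 * z.im ^ (2 * k)

end Fuchsian

/-! Everything rests on a pointwise bound `|f(z)|² y^(2k) ≤ C k ‖f‖²` with `C` depending only on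
`Γ₀`. On the Euclidean disc of radius `y / (2√k)` about `z`, the weight `Im(w)^(2k)` is, up to
bounded factors, `y^(2k)` times the squared modulus of a zero-free holomorphic function. So the area
mean value inequality applies to the weighted `f`. The disc has hyperbolic area of order `1/k`,
whence the linear factor (`ofReal_normSq_mul_im_pow_le`).

The disc lies in the unit hyperbolic ball about `z`. Such a ball covers a point of `Γ \ ℍ` at most
`N` times, and cocompactness of `Γ₀` makes `N` uniform in `z` (`exists_encard_le`). Since `Γ ≤ Γ₀`,
the same `N` serves every `Γ` (`setLIntegral_closedBall_le`).

The bound says that evaluation at `z` is a bounded functional, and by duality its squared norm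
dominates the sum over any orthonormal family (`sum_le_of_forall_le`). Integrating that sum over a
fundamental domain, of finite area, bounds the size of the family and gives finite dimension. -/

namespace Fuchsian

/-! ### Mean value inequality on discs -/

theorem lintegral_ofReal_Ioo (r : ℝ) (hr : 0 ≤ r) :
    ∫⁻ ρ in Set.Ioo 0 r, ENNReal.ofReal ρ = ENNReal.ofReal (r ^ 2 / 2) := by
  rw [← ofReal_integral_eq_lintegral_ofReal]
  · rw [← integral_Ioc_eq_integral_Ioo, ← intervalIntegral.integral_of_le hr, integral_id]
    simp
  · exact (continuous_id.integrableOn_Icc).mono_set Set.Ioo_subset_Icc_self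
  · filter_upwards [ae_restrict_mem measurableSet_Ioo] with x hx using hx.1.le

theorem enorm_mul_le_lintegral_circleMap {h : ℂ → ℂ} {c : ℂ} {r : ℝ} (hr : 0 < r)
    (hh : DifferentiableOn ℂ h (Metric.closedBall c r)) :
    ENNReal.ofReal (2 * Real.pi) * ‖h c‖ₑ ≤
      ∫⁻ θ in Set.Ioo (-Real.pi) Real.pi, ‖h (circleMap c r θ)‖ₑ := by
  have h1 : Real.circleAverage h c r = h c := by
    refine DiffContOnCl.circleAverage ?_
    rw [abs_of_pos hr]
    exact hh.diffContOnCl_ball subset_rfl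
  have h2 : ∫ θ in Set.Ioo (-Real.pi) Real.pi, h (circleMap c r θ) = (2 * Real.pi) • h c := by
    rw [← h1, Real.circleAverage_def, ← integral_Ioc_eq_integral_Ioo,
      ← intervalIntegral.integral_of_le (by linarith [Real.pi_pos])]
    have hp : Function.Periodic (fun θ => h (circleMap c r θ)) (2 * Real.pi) :=
      fun θ => by simp only [periodic_circleMap c r θ]
    have := hp.intervalIntegral_add_eq (-Real.pi) 0
    rw [show -Real.pi + 2 * Real.pi = Real.pi by ring, zero_add] at this
    rw [this, smul_smul, mul_inv_cancel₀ (by positivity), one_smul]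
  calc ENNReal.ofReal (2 * Real.pi) * ‖h c‖ₑ
      = ‖∫ θ in Set.Ioo (-Real.pi) Real.pi, h (circleMap c r θ)‖ₑ := by
        rw [h2, enorm_smul, Real.enorm_eq_ofReal (by positivity)]
    _ ≤ _ := enorm_integral_le_lintegral_enorm _

/-- The area mean value inequality for holomorphic functions. -/
theorem enorm_mul_area_le_lintegral {h : ℂ → ℂ} {c : ℂ} {r : ℝ} (hr : 0 < r)
    (hh : DifferentiableOn ℂ h (Metric.closedBall c r)) :
    ENNReal.ofReal (Real.pi * r ^ 2) * ‖h c‖ₑ ≤ ∫⁻ w in Metric.ball c r, ‖h w‖ₑ := by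
  have hm : MeasurableSet (Metric.ball c r) := Metric.isOpen_ball.measurableSet
  -- `h` is controlled only on the disc; extension by zero gives a measurable function on all of
  -- `ℂ`, as polar coordinates require.
  set F : ℂ → ENNReal := (Metric.ball c r).indicator fun w => ‖h w‖ₑ with hF
  have hFm : Measurable F := by
    refine measurable_of_restrict_of_restrict_compl hm ?_ ?_
    · have : Continuous ((Metric.ball c r).domRestrict h) :=
        continuousOn_iff_continuous_domRestrict.mp
          (hh.continuousOn.mono Metric.ball_subset_closedBall)
      convert this.measurable.enorm using 1
      ext ⟨w, hw⟩
      simp only [Set.domRestrict_apply, F]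
      exact Set.indicator_of_mem hw _
    · convert measurable_const (a := (0 : ENNReal)) using 1
      ext ⟨w, hw⟩
      simp only [Set.domRestrict_apply, F]
      exact Set.indicator_of_notMem hw _
  have hpc : ∀ ρ θ : ℝ, c + Complex.polarCoord.symm (ρ, θ) = circleMap c ρ θ := by
    intro ρ θ
    rw [Complex.polarCoord_symm_apply, circleMap, Complex.exp_mul_I]
    push_cast
    ring
  rw [← lintegral_indicator hm, ← lintegral_add_left_eq_self F c,
    ← Complex.lintegral_comp_polarCoord_symm]
  rw [polarCoord_target, Measure.volume_eq_prod, ← Measure.prod_restrict,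
    lintegral_prod _ (by
      refine Measurable.aemeasurable ?_
      refine (measurable_fst.ennreal_ofReal).smul (hFm.comp ?_)
      simp only [hpc]
      unfold circleMap
      fun_prop)]
  calc ENNReal.ofReal (Real.pi * r ^ 2) * ‖h c‖ₑ
      = ∫⁻ ρ in Set.Ioo 0 r, ENNReal.ofReal ρ * (ENNReal.ofReal (2 * Real.pi) * ‖h c‖ₑ) := by
        rw [lintegral_mul_const _ (by fun_prop), lintegral_ofReal_Ioo r hr.le, ← mul_assoc,
          ← ENNReal.ofReal_mul (by positivity)]
        congr 2
        ring
    _ ≤ ∫⁻ ρ in Set.Ioo 0 r, ∫⁻ θ in Set.Ioo (-Real.pi) Real.pi,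
          ENNReal.ofReal ρ • F (c + Complex.polarCoord.symm (ρ, θ)) := by
        refine setLIntegral_mono' measurableSet_Ioo fun ρ hρ => ?_
        simp only [smul_eq_mul]
        rw [lintegral_const_mul' _ _ ENNReal.ofReal_ne_top]
        gcongr
        refine (enorm_mul_le_lintegral_circleMap hρ.1
          (hh.mono (Metric.closedBall_subset_closedBall hρ.2.le))).trans ?_
        refine lintegral_mono fun θ => ?_
        rw [hpc, hF, Set.indicator_of_mem]
        rw [mem_ball_iff_norm, circleMap_sub_center, norm_circleMap_zero, abs_of_pos hρ.1]
        exact hρ.2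
    _ ≤ _ := lintegral_mono_set Set.Ioo_subset_Ioi_self

/-! ### Local bound with linear growth in the weight -/

theorem setLIntegral_coe_image (s : Set ℍ) (hs : MeasurableSet s) (F : ℂ → ENNReal) :
    ∫⁻ w in UpperHalfPlane.coe '' s, F w =
      ∫⁻ w in s, F w * ENNReal.ofReal (w.im ^ 2) := by
  have hmp : MeasurePreserving UpperHalfPlane.coe (volume.comap UpperHalfPlane.coe)
      (volume.restrict (.range UpperHalfPlane.coe)) :=
    ⟨measurable_coe, by rw [measurableEmbedding_coe.map_comap]⟩
  have hd : Measurable fun z : ℍ =>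
      (((1 / NNReal.mk z.im z.im_pos.le : NNReal) ^ 2 : NNReal) : ENNReal) := by
    refine Measurable.coe_nnreal_ennreal (Continuous.measurable ?_)
    refine .pow (.div₀ continuous_const ?_ ?_) _
    · exact continuous_im.subtype_mk _
    · exact fun x ↦ NNReal.ne_iff.mp x.im_ne_zero
  rw [volume_def, setLIntegral_withDensity_eq_setLIntegral_mul_non_measurable _ hd _ hs
    (by simp),
    ← Set.inter_eq_self_of_subset_left (Set.image_subset_range _ _),
    ← Measure.restrict_restrict', ← hmp.setLIntegral_comp_emb measurableEmbedding_coe]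
  · refine lintegral_congr fun w => ?_
    have hw : ((1 / NNReal.mk w.im w.im_pos.le : NNReal) ^ 2 : NNReal) *
        ENNReal.ofReal (w.im ^ 2) = 1 := by
      rw [ENNReal.ofReal_pow w.im_pos.le, ENNReal.ofReal, Real.toNNReal_of_nonneg w.im_pos.le]
      norm_cast
      ext
      simp [w.im_ne_zero]
    rw [Pi.mul_apply, mul_left_comm, hw, mul_one]
  · exact measurableEmbedding_coe.measurableSet_range

/-- The reciprocal exponential is at least `1 - x + 2x²`, and `(1 + x)(1 - x + 2x²) = 1 + x²(1 + 2x)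
≥ 1`. -/
theorem exp_sub_le {x : ℝ} (hx : -(1 / 2) ≤ x) : Real.exp (x - 2 * x ^ 2) ≤ 1 + x := by
  have h1 : 1 - x + 2 * x ^ 2 ≤ Real.exp (2 * x ^ 2 - x) := by
    linarith [Real.add_one_le_exp (2 * x ^ 2 - x)]
  have h2 : Real.exp (x - 2 * x ^ 2) * Real.exp (2 * x ^ 2 - x) = 1 := by
    rw [← Real.exp_add]; simp
  have h3 : 0 < 1 - x + 2 * x ^ 2 := by nlinarith [sq_nonneg (x - 1)]
  have h4 : 1 ≤ (1 + x) * (1 - x + 2 * x ^ 2) := by nlinarith [sq_nonneg x]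
  have h5 := Real.exp_pos (x - 2 * x ^ 2)
  by_contra! h
  nlinarith

/-- The `2k`-th power of `exp_sub_le` loses only `exp (4 k x²) ≤ e`; this dictates the radius of
order `y / √k` below. -/
theorem exp_le_pow {k : ℕ} {x : ℝ} (hx : -(1 / 2) ≤ x) (hk : k * x ^ 2 ≤ 1 / 4) :
    Real.exp (2 * k * x) ≤ Real.exp 1 * (1 + x) ^ (2 * k) := by
  have h := pow_le_pow_left₀ (Real.exp_pos _).le (exp_sub_le hx) (2 * k)
  rw [← Real.exp_nat_mul] at h
  calc Real.exp (2 * k * x)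
      = Real.exp (4 * (k * x ^ 2)) * Real.exp ((2 * k : ℕ) * (x - 2 * x ^ 2)) := by
        rw [← Real.exp_add]; push_cast; ring_nf
    _ ≤ _ := by gcongr; linarith

/-- The local bound for a holomorphic function weighted by `y ^ (2k)`: the constant grows only
linearly with the weight. -/
theorem ofReal_normSq_mul_im_pow_le {f : ℍ → ℂ} 
    (hf : DifferentiableOn ℂ (f ∘ ofComplex) {z | 0 < z.im}) {k : ℕ} (hk : 0 < k) (z : ℍ) :
    ENNReal.ofReal (‖f z‖ ^ 2 * z.im ^ (2 * k)) ≤ ENNReal.ofReal (9 * k) *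
      ∫⁻ w in Metric.closedBall z 1, ENNReal.ofReal (‖f w‖ ^ 2 * w.im ^ (2 * k)) := by
  have hk1 : (1 : ℝ) ≤ k := by exact_mod_cast hk
  have hy := z.im_pos
  set y := z.im with hydef
  set r : ℝ := y / (2 * √k) with hr
  have hsk : 1 ≤ √(k : ℝ) := Real.one_le_sqrt.mpr hk1
  have hr0 : 0 < r := by positivity
  have hry : r ≤ y / 2 := by
    rw [hr]; gcongr; linarith
  have hr2 : r ^ 2 = y ^ 2 / (4 * k) := by
    rw [hr, div_pow, mul_pow, Real.sq_sqrt (by positivity)]; norm_num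
  have him : ∀ w : ℂ, dist w z ≤ r → |w.im - y| ≤ r := fun w hw => by
    have := Complex.abs_im_le_norm (w - z)
    rw [← dist_eq_norm] at this
    simpa using this.trans hw
  -- The exponential is the holomorphic stand-in for the weight: with `x = (Im w - y) / y`, its
  -- squared modulus is `exp (2kx)`, comparable to `(Im w / y)^(2k) = (1 + x)^(2k)`.
  set h : ℂ → ℂ := fun w =>
    ((f ∘ ofComplex) w * Complex.exp (-Complex.I * k * (w - z) / y)) ^ 2 with hh
  have hsub : Metric.closedBall (z : ℂ) r ⊆ {w | 0 < w.im} := fun w hw => by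
    have := abs_le.mp (him w hw)
    simp only [Set.mem_ofPred_eq]
    linarith
  have hdiff : DifferentiableOn ℂ h (Metric.closedBall z r) := by
    refine ((hf.mono hsub).mul ?_).pow 2
    fun_prop
  have hnorm : ∀ w : ℍ, ‖h w‖ = ‖f w‖ ^ 2 * Real.exp (2 * k * ((w.im - y) / y)) := by
    intro w
    rw [hh]
    simp only [Function.comp_apply, ofComplex_apply, norm_pow, norm_mul, mul_pow]
    congr 1
    rw [Complex.norm_exp, ← Real.exp_nat_mul]
    congr 1
    rw [Complex.div_ofReal_re]
    simp
    ring
  set s : Set ℍ := UpperHalfPlane.coe ⁻¹' Metric.ball (z : ℂ) r with hs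
  have hsm : MeasurableSet s := measurable_coe Metric.isOpen_ball.measurableSet
  have himg : UpperHalfPlane.coe '' s = Metric.ball (z : ℂ) r := by
    refine Set.image_preimage_eq_of_subset fun w hw => ?_
    exact ⟨⟨w, hsub (Metric.ball_subset_closedBall hw)⟩, rfl⟩
  have hball : s ⊆ Metric.closedBall z 1 := by
    intro w hw
    have hw' : dist (w : ℂ) z < r := hw
    have h1 : y / 2 ≤ w.im := by
      have := abs_le.mp (him w hw'.le)
      have h2 : (w : ℂ).im = w.im := rfl
      linarith
    refine (dist_le_dist_coe_div_sqrt w z).trans ?_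
    rw [div_le_one (Real.sqrt_pos.mpr (mul_pos w.im_pos hy))]
    refine Real.le_sqrt_of_sq_le ?_
    have : dist (w : ℂ) z ^ 2 ≤ (y / 2) ^ 2 := by
      gcongr; linarith
    nlinarith
  have hmain := enorm_mul_area_le_lintegral hr0 hdiff
  rw [← himg, setLIntegral_coe_image s hsm] at hmain
  have hpt : ∀ w ∈ s, ‖h w‖ₑ * ENNReal.ofReal (w.im ^ 2) ≤
      ENNReal.ofReal (Real.exp 1 * (9 / 4) * y ^ 2 / y ^ (2 * k)) *
        ENNReal.ofReal (‖f w‖ ^ 2 * w.im ^ (2 * k)) := by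
    intro w hw
    have hw' : dist (w : ℂ) z < r := hw
    have h1 : |w.im - y| ≤ r := him w hw'.le
    have h2 := abs_le.mp h1
    have hwi := w.im_pos
    set x := (w.im - y) / y with hx
    have hwx : w.im = y * (1 + x) := by rw [hx]; field_simp; ring
    have hx2 : -(1 / 2) ≤ x := by rw [hx, le_div_iff₀ hy]; linarith
    have hkx : k * x ^ 2 ≤ 1 / 4 := by
      have : (w.im - y) ^ 2 ≤ r ^ 2 := sq_le_sq' h2.1 h2.2
      rw [hr2] at this
      rw [hx, div_pow, ← mul_div_assoc, div_le_iff₀ (by positivity)]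
      rw [le_div_iff₀ (by positivity)] at this
      linarith
    rw [← ofReal_norm, ← ENNReal.ofReal_mul (norm_nonneg _),
      ← ENNReal.ofReal_mul (by positivity)]
    refine ENNReal.ofReal_le_ofReal ?_
    rw [hnorm, ← hx]
    have h3 := exp_le_pow hx2 hkx
    have h5 : 0 ≤ (1 + x) ^ (2 * k) := (even_two_mul k).pow_nonneg _
    -- From `Im w ≤ 3y/2`; this factor absorbs the density of the hyperbolic area.
    have h4 : w.im ^ 2 ≤ 9 / 4 * y ^ 2 := by nlinarith
    calc ‖f w‖ ^ 2 * Real.exp (2 * k * x) * w.im ^ 2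
        ≤ ‖f w‖ ^ 2 * (Real.exp 1 * (1 + x) ^ (2 * k)) * (9 / 4 * y ^ 2) := by gcongr
      _ = _ := by
        rw [hwx, mul_pow]; field_simp
  have hmain2 := hmain.trans (setLIntegral_mono' hsm hpt)
  rw [lintegral_const_mul' _ _ ENNReal.ofReal_ne_top, ← ofReal_norm, hnorm, ← hydef,
    sub_self, zero_div, mul_zero, Real.exp_zero, mul_one] at hmain2
  set Y : ℝ := y ^ (2 * k) with hY
  have hY0 : 0 < Y := by positivity
  calc ENNReal.ofReal (‖f z‖ ^ 2 * Y)
      = ENNReal.ofReal (Y / (Real.pi * r ^ 2)) *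
          (ENNReal.ofReal (Real.pi * r ^ 2) * ENNReal.ofReal (‖f z‖ ^ 2)) := by
        rw [← ENNReal.ofReal_mul (by positivity), ← ENNReal.ofReal_mul (by positivity)]
        congr 1
        field_simp
    _ ≤ ENNReal.ofReal (Y / (Real.pi * r ^ 2)) *
          (ENNReal.ofReal (Real.exp 1 * (9 / 4) * y ^ 2 / Y) *
            ∫⁻ w in s, ENNReal.ofReal (‖f w‖ ^ 2 * w.im ^ (2 * k))) := by gcongr
    _ ≤ _ := by
        rw [← mul_assoc, ← ENNReal.ofReal_mul (by positivity)]
        refine mul_le_mul' (ENNReal.ofReal_le_ofReal ?_) (lintegral_mono_set hball)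
        rw [hr2]
        -- The constants multiply to `9k · e/π`.
        have he : Real.exp 1 ≤ Real.pi := by
          linarith [Real.exp_one_lt_d9, Real.pi_gt_three]
        calc _ = 9 * k * (Real.exp 1 / Real.pi) := by field_simp
          _ ≤ 9 * k * 1 := by
            gcongr
            exact (div_le_one Real.pi_pos).mpr he
          _ = _ := mul_one _

/-! ### Cocompactness, counting and unfolding -/

theorem dist_psl_smul (g : PSL(2, ℝ)) (z w : ℍ) : dist (g • z) (g • w) = dist z w := by
  induction g using QuotientGroup.induction_on with
  | H g => exact dist_smul g z w

theorem IsCocompact.exists_isCompact {Γ : Subgroup PSL(2, ℝ)} (hc : IsCocompact Γ) :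
    ∃ K : Set ℍ, IsCompact K ∧ ∀ z : ℍ, ∃ g ∈ Γ, g • z ∈ K := by
  have : CompactSpace (MulAction.orbitRel.Quotient Γ ℍ) := hc
  have : ContinuousConstSMul Γ ℍ := ⟨fun γ => continuous_const_smul (γ : PSL(2, ℝ))⟩
  let π : ℍ → MulAction.orbitRel.Quotient Γ ℍ := Quotient.mk''
  have hopen : IsOpenMap π := isOpenMap_quotient_mk'_mul
  obtain ⟨n, hn⟩ := (isCompact_univ (X := MulAction.orbitRel.Quotient Γ ℍ)).elim_directed_cover
    (fun n : ℕ => π '' Metric.ball I n) (fun n => hopen _ Metric.isOpen_ball)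
    (fun x _ => by
      obtain ⟨z, rfl⟩ := Quotient.exists_rep x
      obtain ⟨n, hn⟩ := exists_nat_gt (dist z I)
      exact Set.mem_iUnion.mpr ⟨n, z, hn, rfl⟩)
    (Monotone.directed_le fun m n hmn => Set.image_mono (Metric.ball_subset_ball (by
      exact_mod_cast hmn)))
  refine ⟨Metric.closedBall I n, isCompact_closedBall _ _, fun z => ?_⟩
  obtain ⟨w, hw, hwz⟩ := hn (Set.mem_univ (π z))
  obtain ⟨g, hg⟩ := (MulAction.orbitRel_apply.mp (Quotient.exact hwz) : w ∈ MulAction.orbit Γ z)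
  refine ⟨g, g.2, ?_⟩
  have hg' : (g : PSL(2, ℝ)) • z = w := hg
  rw [hg']
  exact Metric.ball_subset_closedBall hw

/-- Finitely many translates of a compact set for `Γ₀`, by inverses of coset representatives,
suffice for `Γ`. -/
theorem exists_isCompact_of_isFiniteRelIndex {Γ₀ Γ : Subgroup PSL(2, ℝ)} (hc : IsCocompact Γ₀)
    (hi : Γ.IsFiniteRelIndex Γ₀) :
    ∃ K : Set ℍ, IsCompact K ∧ ∀ z : ℍ, ∃ g ∈ Γ, g • z ∈ K := by
  obtain ⟨K, hK, h⟩ := hc.exists_isCompact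
  have : (Γ.subgroupOf Γ₀).FiniteIndex := Subgroup.IsFiniteRelIndex.to_finiteIndex_subgroupOf
  have : Finite (Γ₀ ⧸ Γ.subgroupOf Γ₀) := Subgroup.finite_quotient_of_finiteIndex
  refine ⟨⋃ q : Γ₀ ⧸ Γ.subgroupOf Γ₀, (fun z => (q.out : PSL(2, ℝ))⁻¹ • z) '' K,
    isCompact_iUnion fun q => hK.image (continuous_const_smul _), fun z => ?_⟩
  obtain ⟨g, hg, hgz⟩ := h z
  obtain ⟨t, ht⟩ := QuotientGroup.mk_out_eq_mul (Γ.subgroupOf Γ₀) ⟨g, hg⟩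
  refine ⟨((t : Γ₀) : PSL(2, ℝ))⁻¹, Γ.inv_mem t.2, Set.mem_iUnion.mpr
    ⟨QuotientGroup.mk ⟨g, hg⟩, g • z, hgz, ?_⟩⟩
  rw [ht]
  simp [smul_smul]

/-- For a cocompact Fuchsian group, the number of elements moving a unit ball to one that meets
it is uniformly bounded. -/
theorem exists_encard_le {Γ : Subgroup PSL(2, ℝ)} (hF : IsFuchsian Γ) (hc : IsCocompact Γ) :
    ∃ N : ℕ, ∀ z : ℍ, {g : PSL(2, ℝ) | g ∈ Γ ∧
      ∃ w ∈ Metric.closedBall z 1, g • w ∈ Metric.closedBall z 1}.encard ≤ N := by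
  have : DiscreteTopology Γ := hF
  have := properlyDiscontinuous Γ
  obtain ⟨K, hK, h⟩ := hc.exists_isCompact
  have hK' : IsCompact (Metric.cthickening 1 K) := hK.cthickening
  have hfin := ProperlyDiscontinuousSMul.finite_disjoint_inter_image (Γ := Γ) hK' hK'
  refine ⟨hfin.toFinset.card, fun z => ?_⟩
  obtain ⟨a, ha, haz⟩ := h z
  have hmem : ∀ w ∈ Metric.closedBall z 1, a • w ∈ Metric.cthickening 1 K := fun w hw =>
    Metric.mem_cthickening_of_dist_le _ (a • z) _ _ haz (by rw [dist_psl_smul]; exact hw)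
  rw [← Set.encard_coe_eq_coe_finsetCard, hfin.coe_toFinset,
    ← (Subtype.val_injective (p := fun g => g ∈ Γ)).encard_image,
    -- Conjugation by `a`, which moves `z` into `K`, carries the set to be counted into a fixed
    -- finite set attached to the thickened `K`.
    ← (MulAut.conj a).injective.encard_image]
  refine Set.encard_le_encard ?_
  rintro _ ⟨g, ⟨hg, w, hw, hgw⟩, rfl⟩
  refine ⟨⟨a * g * a⁻¹, Γ.mul_mem (Γ.mul_mem ha hg) (Γ.inv_mem ha)⟩, ?_, rfl⟩
  refine ⟨a • g • w, ⟨a • w, hmem w hw, ?_⟩, hmem _ hgw⟩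
  change (a * g * a⁻¹) • a • w = _
  simp [smul_smul]

/-- Unfolding weights `F x`, for `x` in `D`, by the number of `g` in `Γ` with `g x` in the ball.
Fixing one such `a`, the map `g ↦ g a⁻¹` injects these into the set bounded by `N`. -/
theorem setLIntegral_closedBall_le {Γ₀ Γ : Subgroup PSL(2, ℝ)} (hΓ : Γ ≤ Γ₀) [Countable Γ]
    {N : ℕ} {z : ℍ} (hN : {g : PSL(2, ℝ) | g ∈ Γ₀ ∧
      ∃ w ∈ Metric.closedBall z 1, g • w ∈ Metric.closedBall z 1}.encard ≤ N)
    {D : Set ℍ} (hD : IsFundamentalDomain Γ D volume) {F : ℍ → ENNReal} (hF : Measurable F)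
    (hinv : ∀ g ∈ Γ, ∀ w, F (g • w) = F w) :
    ∫⁻ w in Metric.closedBall z 1, F w ≤ N * ∫⁻ w in D, F w := by
  have hB : MeasurableSet (Metric.closedBall z 1) := Metric.isClosed_closedBall.measurableSet
  have : ContinuousConstSMul Γ ℍ := ⟨fun γ => continuous_const_smul (γ : PSL(2, ℝ))⟩
  rw [← lintegral_indicator hB, hD.lintegral_eq_tsum'', ← lintegral_tsum,
    ← lintegral_const_mul _ hF]
  · refine lintegral_mono fun x => ?_
    have h1 : ∀ g : Γ, (Metric.closedBall z 1).indicator F (g • x) =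
        {g : Γ | g • x ∈ Metric.closedBall z 1}.indicator (fun _ => F x) g := by
      intro g
      by_cases hg : g • x ∈ Metric.closedBall z 1
      · rw [Set.indicator_of_mem hg, Set.indicator_of_mem (by exact hg)]
        exact hinv g g.2 x
      · rw [Set.indicator_of_notMem hg, Set.indicator_of_notMem (by exact hg)]
    simp_rw [h1]
    rw [← tsum_subtype, ENNReal.tsum_set_const]
    gcongr
    rcases Set.eq_empty_or_nonempty {g : Γ | g • x ∈ Metric.closedBall z 1} with h | ⟨a, ha⟩
    · rw [h]; simp
    have h2 : {g : Γ | g • x ∈ Metric.closedBall z 1}.encard ≤ N := by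
      refine le_trans ?_ hN
      rw [← (Subtype.val_injective (p := fun g => g ∈ Γ)).encard_image,
        ← (mul_left_injective (a : PSL(2, ℝ))⁻¹).encard_image]
      refine Set.encard_le_encard ?_
      rintro _ ⟨_, ⟨g, hg, rfl⟩, rfl⟩
      refine ⟨Γ₀.mul_mem (hΓ g.2) (Γ₀.inv_mem (hΓ a.2)), a • x, ha, ?_⟩
      change ((g : PSL(2, ℝ)) * (a : PSL(2, ℝ))⁻¹) • (a : PSL(2, ℝ)) • x ∈ _
      rw [smul_smul, inv_mul_cancel_right]
      exact hg
    exact_mod_cast h2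
  · exact fun g => ((hF.indicator hB).comp (measurable_const_smul g)).aemeasurable

/-- The translates of `K` cover `D`, and their parts in `D` have total area `volume K`. -/
theorem measure_lt_top_of_isCompact {Γ : Subgroup PSL(2, ℝ)} [Countable Γ] {D K : Set ℍ}
    (hD : IsFundamentalDomain Γ D volume) (hK : IsCompact K)
    (h : ∀ z : ℍ, ∃ g ∈ Γ, g • z ∈ K) : volume D < ⊤ := by
  refine lt_of_le_of_lt (b := volume K) ?_ hK.measure_lt_top
  rw [hD.measure_eq_tsum K]
  refine le_trans (measure_mono ?_) (measure_iUnion_le _)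
  intro z hz
  obtain ⟨g, hg, hgz⟩ := h z
  exact Set.mem_iUnion.mpr ⟨⟨g, hg⟩⁻¹, Set.mem_smul_set.mpr ⟨_, hgz, inv_smul_smul g z⟩, hz⟩

/-! ### The Petersson inner product -/

variable {Γ : Subgroup PSL(2, ℝ)} {k : ℕ}

/-- The integrand of the Petersson inner product. -/
noncomputable def peterssonIntegrand (f g : CuspForms Γ k) (z : ℍ) : ℂ :=
  f z * (starRingEnd ℂ) (g z) * (z.im : ℂ) ^ (2 * k)

theorem peterssonIntegrand_eq (f g : CuspForms Γ k) (z : ℍ) :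
    peterssonIntegrand f g z = petersson (2 * k : ℤ) g f z := by
  rw [peterssonIntegrand, petersson, mul_comm (f z)]
  norm_cast

theorem peterssonIntegrand_self (f : CuspForms Γ k) (z : ℍ) :
    peterssonIntegrand f f z = ((‖f z‖ ^ 2 * z.im ^ (2 * k) : ℝ) : ℂ) := by
  rw [peterssonIntegrand, Complex.mul_conj, Complex.normSq_eq_norm_sq]
  push_cast
  rfl

theorem peterssonIntegrand_smul (f g : CuspForms Γ k) {γ : PSL(2, ℝ)} (hγ : γ ∈ Γ) (z : ℍ) :
    peterssonIntegrand f g (γ • z) = peterssonIntegrand f g z := by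
  induction γ using QuotientGroup.induction_on with
  | H γ =>
    have h : Matrix.SpecialLinearGroup.toGL γ ∈ matrixGroup Γ := ⟨γ, hγ, rfl⟩
    rw [peterssonIntegrand_eq, peterssonIntegrand_eq]
    exact SlashInvariantFormClass.petersson_smul (f := g) (f' := f) (τ := z) h

theorem continuous_peterssonIntegrand (f g : CuspForms Γ k) :
    Continuous (peterssonIntegrand f g) := by
  have h := petersson_continuous (2 * k : ℤ) (ModularFormClass.continuous g)
    (ModularFormClass.continuous f)
  exact h.congr fun z => (peterssonIntegrand_eq f g z).symm

theorem integrableOn_peterssonIntegrand {D K : Set ℍ} (hD : volume D < ⊤) (hK : IsCompact K)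
    (h : ∀ z : ℍ, ∃ g ∈ Γ, g • z ∈ K) (f g : CuspForms Γ k) :
    IntegrableOn (peterssonIntegrand f g) D := by
  -- A bound on `K` is global by invariance.
  obtain ⟨M, hM⟩ := hK.exists_bound_of_continuousOn (continuous_peterssonIntegrand f g).continuousOn
  refine Measure.integrableOn_of_bounded hD.ne
    (continuous_peterssonIntegrand f g).aestronglyMeasurable (M := M) (ae_of_all _ fun z => ?_)
  obtain ⟨γ, hγ, hz⟩ := h z
  rw [← peterssonIntegrand_smul f g hγ]
  exact hM _ hz

theorem peterssonInner_eq (f g : CuspForms Γ k) : peterssonInner Γ k f g =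
    ∫ z in fundamentalDomain Γ, peterssonIntegrand f g z :=
  rfl

theorem peterssonInner_self (f : CuspForms Γ k) : peterssonInner Γ k f f =
    ((∫ z in fundamentalDomain Γ, ‖f z‖ ^ 2 * z.im ^ (2 * k) : ℝ) : ℂ) := by
  simp_rw [peterssonInner_eq, peterssonIntegrand_self]
  exact integral_ofReal

/-- The Petersson inner product as an inner product in the sense of Mathlib (conjugate-linear
in the first variable). -/
noncomputable abbrev peterssonCore
    (hint : ∀ f g : CuspForms Γ k, IntegrableOn (peterssonIntegrand f g) (fundamentalDomain Γ))
    (hdef : ∀ f : CuspForms Γ k, peterssonInner Γ k f f = 0 → f = 0) :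
    InnerProductSpace.Core ℂ (CuspForms Γ k) where
  inner f g := peterssonInner Γ k g f
  conj_inner_symm f g := by
    rw [peterssonInner_eq, peterssonInner_eq, ← integral_conj]
    congr 1
    ext z
    rw [peterssonIntegrand_eq, peterssonIntegrand_eq, petersson_symm, Complex.conj_conj]
  re_inner_nonneg f := by
    rw [peterssonInner_self]
    exact integral_nonneg fun z => mul_nonneg (sq_nonneg _) (pow_nonneg z.im_pos.le _)
  add_left f g h := by
    simp only [peterssonInner_eq]
    rw [← integral_add (hint h f) (hint h g)]
    congr 1
    ext z
    simp [peterssonIntegrand, mul_add, add_mul]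
  smul_left f g r := by
    simp only [peterssonInner_eq]
    rw [← integral_const_mul]
    congr 1
    ext z
    simp only [peterssonIntegrand, FunLike.coe_smul, Pi.smul_apply, smul_eq_mul, map_mul]
    ring
  definite f h := hdef f h

/-! ### From the pointwise bound to orthonormal bases -/

theorem sum_le_of_forall_le {V ι : Type*} [NormedAddCommGroup V] [InnerProductSpace ℂ V]
    [Fintype ι] (e : V →ₗ[ℂ] ℂ) {w C : ℝ} (hC : 0 ≤ C)
    (h : ∀ f, ‖e f‖ ^ 2 * w ≤ C * ‖f‖ ^ 2)
    {v : ι → V} (hv : Orthonormal ℂ v) : ∑ i, ‖e (v i)‖ ^ 2 * w ≤ C := by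
  set S : ℝ := ∑ i, ‖e (v i)‖ ^ 2 with hS
  have hS0 : 0 ≤ S := Finset.sum_nonneg fun i _ => sq_nonneg _
  -- The Riesz vector of `e` on the span of `v`: both `e f` and `‖f‖²` equal `S`, so the hypothesis
  -- reads `S² w ≤ C S`.
  set f : V := ∑ i, (starRingEnd ℂ) (e (v i)) • v i with hf
  have h1 : e f = (S : ℂ) := by
    rw [hf, map_sum, hS]
    push_cast
    refine Finset.sum_congr rfl fun i _ => ?_
    rw [map_smul, smul_eq_mul, mul_comm, Complex.mul_conj, Complex.normSq_eq_norm_sq]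
    push_cast
    rfl
  have h2 : ‖f‖ ^ 2 = S := by
    have := hv.inner_sum (fun i => (starRingEnd ℂ) (e (v i)))
      (fun i => (starRingEnd ℂ) (e (v i))) Finset.univ
    rw [← hf, inner_self_eq_norm_sq_to_K] at this
    have h3 : ((‖f‖ ^ 2 : ℝ) : ℂ) = S := by
      rw [hS]
      push_cast
      refine this.trans (Finset.sum_congr rfl fun i _ => ?_)
      rw [Complex.conj_conj, Complex.mul_conj, Complex.normSq_eq_norm_sq]
      push_cast
      rfl
    exact_mod_cast h3
  have h4 := h f
  rw [h1, h2, Complex.norm_real, Real.norm_of_nonneg hS0] at h4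
  rw [← Finset.sum_mul, ← hS]
  rcases hS0.eq_or_lt with h0 | h0
  · rw [← h0, zero_mul]; exact hC
  · nlinarith

theorem normSq_mul_im_pow_le {Γ₀ Γ : Subgroup PSL(2, ℝ)} (hΓ : Γ ≤ Γ₀) [Countable Γ] {N : ℕ}
    (hN : ∀ z : ℍ, {g : PSL(2, ℝ) | g ∈ Γ₀ ∧
      ∃ w ∈ Metric.closedBall z 1, g • w ∈ Metric.closedBall z 1}.encard ≤ N)
    (hD : IsFundamentalDomain Γ (fundamentalDomain Γ) volume) {k : ℕ} (hk : 0 < k)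
    (f : CuspForms Γ k)
    (hint : IntegrableOn (peterssonIntegrand f f) (fundamentalDomain Γ)) (z : ℍ) :
    ‖f z‖ ^ 2 * z.im ^ (2 * k) ≤
      9 * N * k * ∫ w in fundamentalDomain Γ, ‖f w‖ ^ 2 * w.im ^ (2 * k) := by
  have hφ : ∀ w : ℍ, ‖f w‖ ^ 2 * w.im ^ (2 * k) = ‖peterssonIntegrand f f w‖ := fun w => by
    rw [peterssonIntegrand_self, Complex.norm_real, Real.norm_of_nonneg]
    exact mul_nonneg (sq_nonneg _) (pow_nonneg w.im_pos.le _)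
  have hcont := continuous_peterssonIntegrand f f
  have h1 := ofReal_normSq_mul_im_pow_le
    (UpperHalfPlane.mdifferentiable_iff.mp (ModularFormClass.holo f)) hk z
  have h2 := setLIntegral_closedBall_le hΓ (hN z) hD
    (F := fun w => ENNReal.ofReal (‖f w‖ ^ 2 * w.im ^ (2 * k)))
    (by simp_rw [hφ]; exact hcont.norm.measurable.ennreal_ofReal)
    (fun g hg w => by simp_rw [hφ, peterssonIntegrand_smul f f hg])
  have h3 := h1.trans (mul_le_mul_right h2 _)
  rw [← ofReal_integral_eq_lintegral_ofReal (by simp_rw [hφ]; exact hint.norm)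
    (ae_of_all _ fun w => by simp only [hφ]; exact norm_nonneg _), ← ENNReal.ofReal_natCast N,
    ← ENNReal.ofReal_mul (by positivity), ← ENNReal.ofReal_mul (by positivity)] at h3
  have hI : 0 ≤ ∫ w in fundamentalDomain Γ, ‖f w‖ ^ 2 * w.im ^ (2 * k) :=
    integral_nonneg fun w => by simp only [hφ]; exact norm_nonneg _
  rw [ENNReal.ofReal_le_ofReal_iff (by positivity)] at h3
  linarith

theorem finite_of_orthonormal_card_le {V : Type*} [NormedAddCommGroup V] [InnerProductSpace ℂ V]
    (n : ℕ) (h : ∀ (d : ℕ) (v : Fin d → V), Orthonormal ℂ v → d ≤ n) : Module.Finite ℂ V := by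
  rw [← Module.rank_lt_aleph0_iff]
  refine lt_of_le_of_lt (rank_le (n := n) fun s hs => ?_) Cardinal.natCast_lt_aleph0
  let W := Submodule.span ℂ (s : Set V)
  have : FiniteDimensional ℂ W := FiniteDimensional.span_finset ℂ s
  rw [← finrank_span_finset_eq_card hs]
  exact h _ _ ((stdOrthonormalBasis ℂ W).orthonormal.comp_linearIsometry W.subtypeₗᵢ)

theorem exists_basis_and_sumSq_le {Γ₀ Γ : Subgroup PSL(2, ℝ)} (hΓ : Γ ≤ Γ₀) [Countable Γ] {N : ℕ}
    (hN : ∀ z : ℍ, {g : PSL(2, ℝ) | g ∈ Γ₀ ∧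
      ∃ w ∈ Metric.closedBall z 1, g • w ∈ Metric.closedBall z 1}.encard ≤ N)
    (hD : IsFundamentalDomain Γ (fundamentalDomain Γ) volume) {K : Set ℍ} (hK : IsCompact K)
    (hcov : ∀ z : ℍ, ∃ g ∈ Γ, g • z ∈ K) {k : ℕ} (hk : 0 < k) :
    (∃ b, IsOrthonormalBasis Γ k b) ∧
      ∀ b, IsOrthonormalBasis Γ k b → ∀ z : ℍ, sumSq Γ k b z ≤ 9 * N * k := by
  have hvol : volume (fundamentalDomain Γ) < ⊤ := measure_lt_top_of_isCompact hD hK hcov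
  have hint := integrableOn_peterssonIntegrand (k := k) hvol hK hcov
  have hbd := fun f => normSq_mul_im_pow_le hΓ hN hD hk f (hint f f)
  -- Definiteness comes from the pointwise bound: zero norm forces every value to vanish.
  have hdef : ∀ f : CuspForms Γ k, peterssonInner Γ k f f = 0 → f = 0 := by
    intro f hf
    rw [peterssonInner_self, Complex.ofReal_eq_zero] at hf
    ext z
    have h := hbd f z
    rw [hf, mul_zero] at h
    have h0 : ‖f z‖ ^ 2 ≤ 0 := by
      by_contra! h'
      exact absurd h (not_le.mpr (mul_pos h' (pow_pos z.im_pos _)))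
    simpa using le_antisymm h0 (sq_nonneg _)
  let core := peterssonCore hint hdef
  let _ : NormedAddCommGroup (CuspForms Γ k) := core.toNormedAddCommGroup
  let _ : InnerProductSpace ℂ (CuspForms Γ k) := InnerProductSpace.ofCore core.toCore
  have hinner : ∀ f g : CuspForms Γ k, inner ℂ f g = peterssonInner Γ k g f := fun f g => rfl
  have hnorm : ∀ f : CuspForms Γ k, ∫ w in fundamentalDomain Γ, ‖f w‖ ^ 2 * w.im ^ (2 * k) =
      ‖f‖ ^ 2 := by
    intro f
    have h := inner_self_eq_norm_sq_to_K (𝕜 := ℂ) f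
    rw [hinner, peterssonInner_self] at h
    exact Complex.ofReal_injective (h.trans (Complex.ofReal_pow _ _).symm)
  have hC : (0 : ℝ) ≤ 9 * N * k := by positivity
  have hsum : ∀ (d : ℕ) (v : Fin d → CuspForms Γ k), Orthonormal ℂ v → ∀ z : ℍ,
      ∑ i, ‖v i z‖ ^ 2 * z.im ^ (2 * k) ≤ 9 * N * k := by
    intro d v hv z
    let e : CuspForms Γ k →ₗ[ℂ] ℂ :=
      { toFun := fun f => f z
        map_add' := fun f g => rfl
        map_smul' := fun r f => rfl }
    refine sum_le_of_forall_le e hC (fun f => ?_) hv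
    rw [← hnorm]
    exact hbd f z
  -- Each `v i` contributes `1` to the integral of the sum, which is at most `9 N k` times the area.
  have hcard : ∀ (d : ℕ) (v : Fin d → CuspForms Γ k), Orthonormal ℂ v →
      d ≤ ⌈9 * N * k * (volume (fundamentalDomain Γ)).toReal⌉₊ := by
    intro d v hv
    have hi : ∀ i, IntegrableOn (fun z : ℍ => ‖v i z‖ ^ 2 * z.im ^ (2 * k))
        (fundamentalDomain Γ) := fun i => by
      refine (hint (v i) (v i)).norm.congr (ae_of_all _ fun z => ?_)
      simp only [peterssonIntegrand_self, Complex.norm_real]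
      exact Real.norm_of_nonneg (mul_nonneg (sq_nonneg _) (pow_nonneg z.im_pos.le _))
    have h1 : (d : ℝ) = ∫ z in fundamentalDomain Γ, ∑ i, ‖v i z‖ ^ 2 * z.im ^ (2 * k) := by
      rw [integral_finsetSum _ fun i _ => hi i]
      simp [hnorm, hv.1]
    have h2 : ∫ z in fundamentalDomain Γ, ∑ i, ‖v i z‖ ^ 2 * z.im ^ (2 * k) ≤
        ∫ z in fundamentalDomain Γ, (9 * N * k : ℝ) :=
      integral_mono (integrable_finsetSum _ fun i _ => hi i) (integrableOn_const hvol.ne)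
        (hsum d v hv)
    rw [← h1, setIntegral_const, smul_eq_mul, mul_comm] at h2
    exact_mod_cast h2.trans (Nat.le_ceil _)
  have : Module.Finite ℂ (CuspForms Γ k) := finite_of_orthonormal_card_le _ hcard
  constructor
  · refine ⟨(stdOrthonormalBasis ℂ (CuspForms Γ k)).toBasis, fun i j => ?_⟩
    rw [← hinner, OrthonormalBasis.coe_toBasis,
      orthonormal_iff_ite.mp (stdOrthonormalBasis ℂ (CuspForms Γ k)).orthonormal]
    simp only [eq_comm]
  · intro b hb z
    refine hsum _ b (orthonormal_iff_ite.mpr fun i j => ?_) z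
    rw [hinner, hb]
    simp only [eq_comm]

end Fuchsian

theorem mainTheorem2 (Γ₀ : Subgroup PSL(2, ℝ)) (hF : Fuchsian.IsFuchsian Γ₀)
    (hc : Fuchsian.IsCocompact Γ₀) :
    ∃ C : ℝ, ∀ Γ : Subgroup PSL(2, ℝ), Γ ≤ Γ₀ → Γ.IsFiniteRelIndex Γ₀ →
      ∀ k : ℕ, 0 < k →
        (∃ b, Fuchsian.IsOrthonormalBasis Γ k b) ∧
        ∀ b, Fuchsian.IsOrthonormalBasis Γ k b →
          ∀ z : ℍ, Fuchsian.sumSq Γ k b z ≤ C * k := by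
  obtain ⟨N, hN⟩ := Fuchsian.exists_encard_le hF hc
  refine ⟨9 * N, fun Γ hΓ hi k hk => ?_⟩
  have : DiscreteTopology Γ₀ := hF
  have hΓF : DiscreteTopology Γ := DiscreteTopology.of_subset (t := (Γ : Set PSL(2, ℝ))) this hΓ
  have := Fuchsian.countable_of_discrete Γ
  obtain ⟨K, hK, hcov⟩ := Fuchsian.exists_isCompact_of_isFiniteRelIndex hc hi
  exact Fuchsian.exists_basis_and_sumSq_le hΓ hN (Fuchsian.isFundamentalDomain Γ hΓF) hK hcov hk
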